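/- Let $K$ be a field, and let $\mathbb T$ be the set of terms (monic monomials) in the variables $x_1<\dots<x_n$. For a term $\sigma\neq 1$ let $\min(\sigma)$ be the smallest variable dividing $\sigma$. Let $\mathcal O\subset\mathbb T$ be a finite order ideal (a finite set of terms containing every divisor of each of its members), and put: - $\partial\mathcal O=\{x_i\tau \mid \tau\in\mathcal O,\ 1\le i\le n\}\setminus\mathcal O$, the border of $\mathcal O$, listed as $\beta_1,\dots,\beta_m$ with $\deg\beta_1\le\dots\le\deg\beta_m$ (terms of the same degree in any order); - $\mathcal P_{\mathcal O}=\{\sigma\in\mathbb T\setminus\mathcal O \mid \sigma=1 \text{ or } \sigma/\min(\sigma)\in\mathcal O\}$, the Pommaret basis of the monomial ideal generated by $\mathbb T\setminus\mathcal O$. The multiplicative set of $\beta_i\in\partial\mathcal O$ is $\mathcal T_{\beta_i}=\{\mu\in\mathbb T\mid \beta_j\nmid\beta_i\mu \text{ for all } j>i\}$; that of $\alpha\in\mathcal P_{\mathcal O}$ is $\mathcal T_\alpha=\mathbb T\cap K[x_1,\dots,\min(\alpha)]$ (all of $\mathbb T$ if $\alpha=1$). For $\mathcal H\in\{\partial\mathcal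 O,\mathcal P_{\mathcal O}\}$, each with its own multiplicative sets, let $C_{\mathcal H}=\{C_{\tau\sigma}\mid\tau\in\mathcal H,\ \sigma\in\mathcal O\}$ be a set of parameters, and let $$g_\tau=\tau-\sum_{\sigma\in\mathcal O}C_{\tau\sigma}\,\sigma\in K[C_{\mathcal H}][x_1,\dots,x_n]\qquad(\tau\in\mathcal H)$$ be the generic $\mathcal H$-marked set. A reduction step replaces a polynomial $g$ by $g-c\,\eta\, g_\alpha$, where $\alpha\in\mathcal H$, $\eta\in\mathcal T_\alpha$, and $c\ne0$ is the coefficient of $\alpha\eta$ in $g$; $g$ reduces to $h$ if $h$ is obtained from $g$ by finitely many (possibly no) reduction steps. A polynomial is $\mathcal O$-reduced if all its terms lie in $\mathcal O$. Let $S(g_\alpha,g_{\alpha'})=\eta g_\alpha-\eta' g_{\alpha'}$, where $\eta\alpha=\eta'\alpha'=\mathrm{lcm}(\alpha,\alpha')$. - Let $\mathcal H=\partial\mathcal O$ and $C=C_{\partial\mathcal O}$. Let $\mathfrak B\subset K[C]$ be the ideal generated by the coefficients, with respect to the terms in $x_1,\dots,x_n$, of the $\mathcal O$-reduced polynomials to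 which the polynomials $S(g_\alpha,g_{\alpha'})$ reduce, for all $\alpha,\alpha'\in\partial\mathcal O$ such that $\alpha=x_j\alpha'$ for some $j$ or $x_i\alpha=x_j\alpha'$ for some $i,j$. The border marked scheme of $\mathcal O$ is $\operatorname{Spec}(K[C]/\mathfrak B)$. - Let $\mathcal H=\mathcal P_{\mathcal O}$, and let $K[C\setminus\tilde C]$ denote $K[C_{\mathcal P_{\mathcal O}}]$. Let $\mathfrak P\subset K[C\setminus\tilde C]$ be the ideal generated by the coefficients, with respect to the terms in $x_1,\dots,x_n$, of the $\mathcal O$-reduced polynomials to which the polynomials $S(g_\alpha,g_{\alpha'})$ reduce, for all $\alpha,\alpha'\in\mathcal P_{\mathcal O}$ such that, for some variable $x_i\notin\mathcal T_\alpha$, $x_i\alpha=\delta\alpha'$ with $\delta\in\mathcal T_{\alpha'}$. The Pommaret marked scheme of $\mathcal O$ is $\operatorname{Spec}(K[C\setminus\tilde C]/\mathfrak P)$. Then the border marked scheme $\operatorname{Spec}(K[C]/\mathfrak B)$ and the Pommaret marked scheme $\operatorname{Spec}(K[C\setminus\tilde C]/\mathfrak P)$ of $\mathcal O$ are isomorphic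 as schemes over $K$. -/

import Mathlib

universe u

open CategoryTheory AlgebraicGeometry

noncomputable section

namespace MarkedBases

/-- Terms (monic monomials) in the variables `x₁ < ⋯ < xₙ`, written through their exponents.
The product of terms is `+`, the term `1` is `0`, the variable `x_i` is `Finsupp.single i 1`,
divisibility of terms is `≤`, the least common multiple is `⊔`, and the quotient of a term by
one of its divisors is `-`.  The ordering of the variables is the one of `Fin n`. -/
abbrev Term (n : ℕ) : Type := Fin n →₀ ℕ

/-- The variable `x_i` as a term. -/
abbrev var {n : ℕ} (i : Fin n) : Term n := Finsupp.single i 1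

/-- An order ideal: a set of terms containing every divisor of each of its members. -/
def IsOrderIdeal {n : ℕ} (O : Set (Term n)) : Prop :=
  ∀ σ τ : Term n, τ ∈ O → σ ≤ τ → σ ∈ O

/-- The cone `{τ α | τ ∈ T}` of the term `α` by the set of terms `T`. -/
def cone {n : ℕ} (T : Set (Term n)) (α : Term n) : Set (Term n) :=
  {γ | ∃ τ ∈ T, γ = α + τ}

/-- A reduction structure: a finite set `head` of terms, and for each `α ∈ head` a tail set and
a multiplicative set (the values of `tail` and `mult` off `head` play no role). -/
structure ReductionStructure (n : ℕ) where
  head : Finset (Term n)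
  tail : Term n → Finset (Term n)
  mult : Term n → Set (Term n)
  mult_orderIdeal : ∀ α ∈ head, IsOrderIdeal (mult α)
  /-- the cones cover exactly the terms of the monomial ideal generated by `head` -/
  iUnion_cone : (⋃ α ∈ head, cone (mult α) α) = {γ | ∃ α ∈ head, α ≤ γ}
  tail_disjoint : ∀ α ∈ head, Disjoint (tail α : Set (Term n)) (cone (mult α) α)

/-- The border `{x_i τ | τ ∈ O} ∖ O` of a finite set of terms. -/
def border {n : ℕ} (O : Finset (Term n)) : Finset (Term n) :=
  (O.biUnion fun τ => Finset.univ.image fun i : Fin n => τ + var i) \ O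

theorem mem_border {n : ℕ} {O : Finset (Term n)} {σ : Term n} :
    σ ∈ border O ↔ (∃ τ ∈ O, ∃ i : Fin n, σ = τ + var i) ∧ σ ∉ O := by
  simp [border, eq_comm]

open Classical in
/-- The Pommaret basis of the monomial ideal whose terms are those outside the finite order
ideal `O`: the terms `σ ∉ O` such that `σ / min σ ∈ O`, where `min σ` is the smallest variable
dividing `σ`.  The term `1` has no such variable; it belongs to the Pommaret basis exactly when
it is outside `O` (that is, when `O` is empty).  See `mem_pommaretBasis`. -/
def pommaretBasis {n : ℕ} (O : Finset (Term n)) : Finset (Term n) :=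
  (insert 0 (border O)).filter fun σ =>
    σ ∉ O ∧ ∀ i : Fin n, IsLeast (σ.support : Set (Fin n)) i → σ - var i ∈ O

theorem sub_var_add {n : ℕ} {σ : Term n} {i : Fin n} (hi : i ∈ σ.support) :
    σ - var i + var i = σ := by
  apply tsub_add_cancel_of_le
  rw [Finsupp.single_le_iff]
  exact Nat.one_le_iff_ne_zero.2 (Finsupp.mem_support_iff.1 hi)

theorem exists_isLeast_support {n : ℕ} {σ : Term n} (h : σ ≠ 0) :
    ∃ i : Fin n, IsLeast (σ.support : Set (Fin n)) i :=
  ⟨_, Finset.isLeast_min' _ (Finsupp.support_nonempty_iff.2 h)⟩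

theorem mem_pommaretBasis {n : ℕ} {O : Finset (Term n)} {σ : Term n} :
    σ ∈ pommaretBasis O ↔
      σ ∉ O ∧ ∀ i : Fin n, IsLeast (σ.support : Set (Fin n)) i → σ - var i ∈ O := by
  classical
  unfold pommaretBasis
  rw [Finset.mem_filter, and_iff_right_iff_imp]
  rintro ⟨h1, h2⟩
  by_cases h0 : σ = 0
  · simp [h0]
  · obtain ⟨i, hi⟩ := exists_isLeast_support h0
    refine Finset.mem_insert_of_mem (mem_border.2 ⟨⟨_, h2 i hi, i, ?_⟩, h1⟩)
    exact (sub_var_add (Finset.mem_coe.1 hi.1)).symm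

/-- Tails inside an order ideal avoid the cones of the terms outside it. -/
theorem disjoint_cone {n : ℕ} {O : Finset (Term n)} (hO : IsOrderIdeal (O : Set (Term n)))
    {α : Term n} (hα : α ∉ O) (T : Set (Term n)) :
    Disjoint (O : Set (Term n)) (cone T α) := by
  rw [Set.disjoint_left]
  rintro γ hγ ⟨τ, -, rfl⟩
  exact hα (hO _ _ hγ le_self_add)

/-- The multiplicative sets of the border reduction structure, for an ordering
`β_0, β_1, …` of the border: for `β = β_i` it consists of the terms `μ` such that no `β_j` with
`j > i` divides `β_i μ`. -/
def borderMult {n : ℕ} (O : Finset (Term n)) (β : Fin (border O).card ≃ border O)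
    (b : Term n) : Set (Term n) :=
  {μ | ∀ i j : Fin (border O).card, (β i : Term n) = b → i < j → ¬ (β j : Term n) ≤ b + μ}

/-- The multiplicative sets of the Pommaret reduction structure: the terms in the variables
`x_1, …, min α` (all the terms, if `α = 1`). -/
def pommaretMult {n : ℕ} (α : Term n) : Set (Term n) :=
  {μ | ∀ i ∈ μ.support, ∀ j ∈ α.support, i ≤ j}

theorem exists_mem_cone_border {n : ℕ} (O : Finset (Term n))
    (β : Fin (border O).card ≃ border O) {γ : Term n} (h : ∃ α ∈ border O, α ≤ γ) :
    ∃ α ∈ border O, γ ∈ cone (borderMult O β α) α := by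
  classical
  obtain ⟨α, hα, hle⟩ := h
  let s : Finset (Fin (border O).card) := Finset.univ.filter fun i => (β i : Term n) ≤ γ
  have hs : s.Nonempty := ⟨β.symm ⟨α, hα⟩, by simp [s, hle]⟩
  have hmax := s.max'_mem hs
  simp only [s, Finset.mem_filter, Finset.mem_univ, true_and] at hmax
  refine ⟨_, (β (s.max' hs)).2, γ - β (s.max' hs), ?_, (add_tsub_cancel_of_le hmax).symm⟩
  intro i j hi hij hj
  rw [add_tsub_cancel_of_le hmax] at hj
  have h1 : i = s.max' hs := β.injective (Subtype.ext hi)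
  have h2 : j ≤ s.max' hs := s.le_max' _ (by simp [s, hj])
  exact absurd hij (not_lt.2 (h1 ▸ h2))

theorem exists_mem_cone_pommaret {n : ℕ} (O : Finset (Term n)) :
    ∀ (d : ℕ) (γ : Term n), γ.degree = d → γ ∉ O →
      ∃ α ∈ pommaretBasis O, γ ∈ cone (pommaretMult α) α := by
  intro d
  induction d with
  | zero =>
    intro γ hd hγ
    have h0 : γ = 0 := (Finsupp.degree_eq_zero_iff γ).1 hd
    subst h0
    refine ⟨0, mem_pommaretBasis.2 ⟨hγ, fun i hi => ?_⟩, 0, ?_, ?_⟩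
    · simpa using hi.1
    · simp [pommaretMult]
    · simp
  | succ d ih =>
    intro γ hd hγ
    have h0 : γ ≠ 0 := by rintro rfl; simp at hd
    obtain ⟨i, hi⟩ := exists_isLeast_support h0
    have hsub := sub_var_add (Finset.mem_coe.1 hi.1)
    by_cases hO : γ - var i ∈ O
    · refine ⟨γ, mem_pommaretBasis.2 ⟨hγ, fun j hj => ?_⟩, 0, ?_, ?_⟩
      · rwa [hj.unique hi]
      · simp [pommaretMult]
      · simp
    · have hdeg : (γ - var i).degree = d := by
        have h := congrArg Finsupp.degree hsub
        rw [map_add, hd, Finsupp.degree_single] at h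
        omega
      obtain ⟨α, hα, μ, hμ, h⟩ := ih _ hdeg hO
      refine ⟨α, hα, μ + var i, ?_, ?_⟩
      · intro k hk j hj
        have hk' := Finsupp.support_add hk
        rw [Finset.mem_union] at hk'
        rcases hk' with hk' | hk'
        · exact hμ k hk' j hj
        · have hki : k = i := by
            have := Finsupp.support_single_subset hk'
            simpa using this
          subst hki
          apply hi.2
          rw [Finset.mem_coe, Finsupp.mem_support_iff] at *
          rw [← hsub, h]
          simp only [Finsupp.coe_add, Pi.add_apply]
          omega
      · rw [← add_assoc, ← h, hsub]

/-- The border reduction structure of a finite order ideal `O`, for an ordering of the border. -/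
def borderRS {n : ℕ} (O : Finset (Term n)) (hO : IsOrderIdeal (O : Set (Term n)))
    (β : Fin (border O).card ≃ border O) : ReductionStructure n where
  head := border O
  tail := fun _ => O
  mult := borderMult O β
  mult_orderIdeal := fun α _ σ τ hτ hle i j hi hij h =>
    hτ i j hi hij (h.trans (by gcongr))
  iUnion_cone := by
    ext γ
    simp only [Set.mem_iUnion, Set.mem_ofPred_eq, exists_prop]
    refine ⟨?_, exists_mem_cone_border O β⟩
    rintro ⟨α, hα, τ, -, rfl⟩
    exact ⟨α, hα, le_self_add⟩
  tail_disjoint := fun α hα => disjoint_cone hO (mem_border.1 hα).2 _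

/-- The Pommaret reduction structure of a finite order ideal `O`. -/
def pommaretRS {n : ℕ} (O : Finset (Term n)) (hO : IsOrderIdeal (O : Set (Term n))) :
    ReductionStructure n where
  head := pommaretBasis O
  tail := fun _ => O
  mult := pommaretMult
  mult_orderIdeal := fun α _ σ τ hτ hle i hi j hj =>
    hτ i (Finsupp.support_mono hle hi) j hj
  iUnion_cone := by
    ext γ
    simp only [Set.mem_iUnion, Set.mem_ofPred_eq, exists_prop]
    constructor
    · rintro ⟨α, hα, τ, -, rfl⟩
      exact ⟨α, hα, le_self_add⟩
    · rintro ⟨α, hα, hle⟩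
      exact exists_mem_cone_pommaret O _ γ rfl
        fun h => (mem_pommaretBasis.1 hα).1 (hO _ _ h hle)
  tail_disjoint := fun α hα => disjoint_cone hO (mem_pommaretBasis.1 hα).1 _

section Reduction

variable {n : ℕ} {A : Type u} [CommRing A]

/-- One reduction step by a family `F` of polynomials, `F α` being marked at `α ∈ head`: a term
`γ = α η` of the support of `g`, with `η` multiplicative for `α`, is eliminated by subtracting
`c η F_α`, where `c` is the coefficient of `γ` in `g`. -/
def ReductionStructure.Step (J : ReductionStructure n)
    (F : J.head → MvPolynomial (Fin n) A) (g h : MvPolynomial (Fin n) A) : Prop :=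
  ∃ γ ∈ g.support, ∃ (α : J.head) (η : Term n), η ∈ J.mult α ∧ γ = α + η ∧
    h = g - MvPolynomial.monomial η (g.coeff γ) * F α

/-- The reduction relation: finitely many (possibly no) reduction steps. -/
def ReductionStructure.Reduces (J : ReductionStructure n)
    (F : J.head → MvPolynomial (Fin n) A) :
    MvPolynomial (Fin n) A → MvPolynomial (Fin n) A → Prop :=
  Relation.ReflTransGen (J.Step F)

/-- The `S`-polynomial of the polynomials `f`, `f'` marked at the terms `α`, `α'`. -/
def sPoly (α α' : Term n) (f f' : MvPolynomial (Fin n) A) : MvPolynomial (Fin n) A :=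
  MvPolynomial.monomial (α ⊔ α' - α) 1 * f - MvPolynomial.monomial (α ⊔ α' - α') 1 * f'

end Reduction

/-- Neighbour couples of terms: `α = x_j α'`, or `x_i α = x_j α'`. -/
def IsNeighbour {n : ℕ} (α α' : Term n) : Prop :=
  (∃ j : Fin n, α = var j + α') ∨ ∃ i j : Fin n, var i + α = var j + α'

/-- Non-multiplicative couples of terms: some variable `x_i`, not multiplicative for `α`, is such
that `x_i α` lies in the cone of `α'`. -/
def ReductionStructure.IsNonMult {n : ℕ} (J : ReductionStructure n) (α α' : Term n) : Prop :=
  ∃ i : Fin n, var i ∉ J.mult α ∧ var i + α ∈ cone (J.mult α') α'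

/-- The polynomial ring `K[C]` in the parameters `C_{τσ}`, `τ ∈ H`, `σ ∈ O`. -/
abbrev ParamRing (K : Type u) [Field K] {n : ℕ} (H O : Finset (Term n)) : Type u :=
  MvPolynomial (H × O) K

/-- The generic marked set `g_τ = τ - ∑_{σ ∈ O} C_{τσ} σ`, `τ ∈ H`, with coefficients in
`K[C]`. -/
def genericMarkedSet (K : Type u) [Field K] {n : ℕ} (H O : Finset (Term n)) (τ : H) :
    MvPolynomial (Fin n) (ParamRing K H O) :=
  MvPolynomial.monomial (τ : Term n) 1 -
    ∑ σ : O, MvPolynomial.monomial (σ : Term n) (MvPolynomial.X (τ, σ))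

/-- The ideal of `K[C]` generated by the `x`-coefficients of the `O`-reduced polynomials `h` to
which the `S`-polynomials of the couples `(g_α, g_α')` of elements of the generic marked set with
`R α α'` reduce. -/
def coeffIdeal (K : Type u) [Field K] {n : ℕ} (O : Finset (Term n)) (J : ReductionStructure n)
    (R : Term n → Term n → Prop) : Ideal (ParamRing K J.head O) :=
  Ideal.span {c | ∃ α α' : J.head, R α α' ∧
    ∃ h : MvPolynomial (Fin n) (ParamRing K J.head O),
      J.Reduces (genericMarkedSet K J.head O)
        (sPoly α α' (genericMarkedSet K J.head O α) (genericMarkedSet K J.head O α')) h ∧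
      h.support ⊆ O ∧ ∃ γ : Term n, c = h.coeff γ}

/-- The ideal `𝔅 ⊆ K[C]` of the border marked scheme, `C` being indexed by `∂O × O`. -/
def borderIdeal (K : Type u) [Field K] {n : ℕ} (O : Finset (Term n))
    (hO : IsOrderIdeal (O : Set (Term n))) (β : Fin (border O).card ≃ border O) :
    Ideal (ParamRing K (border O) O) :=
  coeffIdeal K O (borderRS O hO β) IsNeighbour

/-- The ideal `𝔓 ⊆ K[C ∖ C̃]` of the Pommaret marked scheme.  The parameters `C ∖ C̃` are those of
the generic marked polynomials with head term in the Pommaret basis. -/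
def pommaretIdeal (K : Type u) [Field K] {n : ℕ} (O : Finset (Term n))
    (hO : IsOrderIdeal (O : Set (Term n))) : Ideal (ParamRing K (pommaretBasis O) O) :=
  coeffIdeal K O (pommaretRS O hO) (pommaretRS O hO).IsNonMult

/-- `Spec S` as a scheme over `Spec K`, for a `K`-algebra `S`. -/
def specOver (K S : Type u) [CommRing K] [CommRing S] [Algebra K S] :
    Over (Spec (CommRingCat.of K)) :=
  Over.mk (Spec.map (CommRingCat.ofHom (algebraMap K S)))

/-- The border marked scheme `Spec (K[C]/𝔅)` of `O`, as a scheme over `K`. -/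
def borderMarkedScheme (K : Type u) [Field K] {n : ℕ} (O : Finset (Term n))
    (hO : IsOrderIdeal (O : Set (Term n))) (β : Fin (border O).card ≃ border O) :
    Over (Spec (CommRingCat.of K)) :=
  specOver K (ParamRing K (border O) O ⧸ borderIdeal K O hO β)

/-- The Pommaret marked scheme `Spec (K[C ∖ C̃]/𝔓)` of `O`, as a scheme over `K`. -/
def pommaretMarkedScheme (K : Type u) [Field K] {n : ℕ} (O : Finset (Term n))
    (hO : IsOrderIdeal (O : Set (Term n))) : Over (Spec (CommRingCat.of K)) :=
  specOver K (ParamRing K (pommaretBasis O) O ⧸ pommaretIdeal K O hO)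

end MarkedBases

end

/-! Both quotient rings represent the same functor. For a `K`-algebra `A`, consider ideals `I` of
`A[x]` with `A[x] = ⟨O⟩ ⊕ I`, where `⟨O⟩` is the free module on `O`. For either choice of heads,
such an ideal contains exactly one marked set, given by the normal forms of the heads, and that set
generates `I`. `Represents` records the two facts needed: a marked ideal together with `⟨O⟩` always
spans `A[x]`, and its coefficients kill the given parameter ideal iff the sum is direct. Computing
the normal forms of one kind of head modulo the universal marked ideal of the other kind gives
algebra maps both ways, and uniqueness of coefficients makes them inverse
(`Represents.nonempty_algEquiv`).

The work is in showing that vanishing of the S-polynomial coefficients forces directness. For the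
border, the neighbour couples say exactly what is needed for the formal multiplication operators on
`A^O` to commute; `A^O` then becomes an `A[x]`-module in which the marked ideal annihilates the
class of `1`, while elements of `⟨O⟩` act on that class faithfully
(`eq_zero_of_mem_markedIdeal_border`). For the Pommaret basis, multipliers are compared in the
colexicographic order. Multiplicative multiples of the marked set meet `⟨O⟩` trivially
(`eq_zero_of_mem_multSpan`), and the non-multiplicative couples allow every multiple to be rewritten
through them (`monomial_mul_markedPoly_mem_multSpan`). -/

noncomputable section

namespace MarkedBases

open MvPolynomial

/-! ### Marked sets over an arbitrary coefficient ring -/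

section Marked

variable {n : ℕ} {H O : Finset (Term n)} {A B : Type*} [CommRing A] [CommRing B]

/-- The polynomial marked at `τ` with coefficients `c`. -/
def markedPoly (c : H × O → A) (τ : H) : MvPolynomial (Fin n) A :=
  monomial (τ : Term n) 1 - ∑ σ : O, monomial (σ : Term n) (c (τ, σ))

/-- The ideal generated by a marked set. -/
def markedIdeal (c : H × O → A) : Ideal (MvPolynomial (Fin n) A) :=
  Ideal.span (Set.range (markedPoly c))

theorem markedPoly_mem (c : H × O → A) (τ : H) : markedPoly c τ ∈ markedIdeal c :=
  Ideal.subset_span ⟨τ, rfl⟩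

theorem map_markedPoly (f : A →+* B) (c : H × O → A) (τ : H) :
    map f (markedPoly c τ) = markedPoly (f ∘ c) τ := by
  simp [markedPoly]

theorem map_mem_markedIdeal (f : A →+* B) {c : H × O → A} {p : MvPolynomial (Fin n) A}
    (hp : p ∈ markedIdeal c) : map f p ∈ markedIdeal (f ∘ c) := by
  have h : markedIdeal c ≤ (markedIdeal (f ∘ c)).comap (map f) := by
    refine Ideal.span_le.2 ?_
    rintro _ ⟨τ, rfl⟩
    simpa [map_markedPoly] using markedPoly_mem (f ∘ c) τ
  exact h hp

theorem tail_mem (c : H × O → A) (τ : H) :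
    ∑ σ : O, monomial (σ : Term n) (c (τ, σ)) ∈ restrictSupport A (O : Set (Term n)) :=
  sum_mem fun σ _ => (monomial_mem_restrictSupport _).2 (Or.inl σ.2)

theorem sum_monomial_coeff {p : MvPolynomial (Fin n) A}
    (hp : p ∈ restrictSupport A (O : Set (Term n))) :
    ∑ σ : O, monomial (σ : Term n) (p.coeff σ) = p := by
  conv_rhs => rw [p.as_sum]
  rw [Finset.sum_coe_sort O fun σ => monomial σ (p.coeff σ)]
  refine (Finset.sum_subset ((mem_restrictSupport_iff _).1 hp) fun σ _ hσ => ?_).symm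
  rw [notMem_support_iff.1 hσ, monomial_zero]

theorem coeff_sum_monomial (f : O → A) (σ : O) :
    (∑ ρ : O, monomial (ρ : Term n) (f ρ)).coeff σ = f σ := by
  classical
  simp [coeff_sum, coeff_monomial]

/-- The coefficients of a marked set in a given ideal `I` are unique if `I` meets the module
generated by `O` trivially. -/
theorem eq_of_markedPoly_mem {I : Ideal (MvPolynomial (Fin n) A)}
    (hI : ∀ h ∈ restrictSupport A (O : Set (Term n)), h ∈ I → h = 0) {c c' : H × O → A}
    (hc : ∀ τ, markedPoly c τ ∈ I) (hc' : ∀ τ, markedPoly c' τ ∈ I) : c = c' := by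
  funext ⟨τ, σ⟩
  have h0 := hI _ (sub_mem (tail_mem c τ) (tail_mem c' τ)) (by
    have := sub_mem (hc' τ) (hc τ)
    simpa only [markedPoly, sub_sub_sub_cancel_left] using this)
  have h1 := congrArg (coeff (σ : Term n)) (sub_eq_zero.1 h0)
  rwa [coeff_sum_monomial fun ρ => c (τ, ρ), coeff_sum_monomial fun ρ => c' (τ, ρ)] at h1

theorem markedIdeal_le {I : Ideal (MvPolynomial (Fin n) A)} {c : H × O → A}
    (hc : ∀ τ, markedPoly c τ ∈ I) : markedIdeal c ≤ I := by
  refine Ideal.span_le.2 ?_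
  rintro _ ⟨τ, rfl⟩
  exact hc τ

end Marked

/-! ### The common functor and the resulting isomorphism -/

/-- An ideal of the parameter ring which cuts out the marked sets whose ideal is a complement of
the module generated by `O`. -/
structure Represents (K : Type u) [Field K] {n : ℕ} {H O : Finset (Term n)}
    (I : Ideal (ParamRing K H O)) : Prop where
  exists_sub_mem : ∀ {A : Type u} [CommRing A] (c : H × O → A) (p : MvPolynomial (Fin n) A),
    ∃ h ∈ restrictSupport A (O : Set (Term n)), p - h ∈ markedIdeal c
  forall_aeval_iff : ∀ {A : Type u} [CommRing A] [Algebra K A] (c : H × O → A),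
    (∀ p ∈ I, aeval c p = 0) ↔
      ∀ h ∈ restrictSupport A (O : Set (Term n)), h ∈ markedIdeal c → h = 0

namespace Represents

variable {K : Type u} [Field K] {n : ℕ} {H H₁ H₂ O : Finset (Term n)}
  {I : Ideal (ParamRing K H O)}
  {I₁ : Ideal (ParamRing K H₁ O)} {I₂ : Ideal (ParamRing K H₂ O)}

/-- The coefficients of the universal marked set. -/
def univ (I : Ideal (ParamRing K H O)) (p : H × O) : ParamRing K H O ⧸ I :=
  Ideal.Quotient.mkₐ K I (X p)

theorem aeval_univ (I : Ideal (ParamRing K H O)) : aeval (univ I) = Ideal.Quotient.mkₐ K I := by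
  ext p
  simp [univ]

theorem eq_zero_of_mem (h : Represents K I) {f : MvPolynomial (Fin n) (ParamRing K H O ⧸ I)}
    (hO : f ∈ restrictSupport _ (O : Set (Term n))) (hf : f ∈ markedIdeal (univ I)) : f = 0 := by
  refine (h.forall_aeval_iff (univ I)).1 (fun p hp => ?_) f hO hf
  rw [aeval_univ]
  exact Ideal.Quotient.eq_zero_iff_mem.2 hp

/-- Normal forms of the heads in `H₂` modulo the universal ideal over `H₁` form a marked set inside
that ideal. Its ideal therefore also meets `⟨O⟩` trivially, so its coefficients kill `I₂`. -/
theorem exists_algHom (h₁ : Represents K I₁) (h₂ : Represents K I₂) :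
    ∃ ψ : (ParamRing K H₂ O ⧸ I₂) →ₐ[K] (ParamRing K H₁ O ⧸ I₁),
      ∀ τ, markedPoly (ψ ∘ univ I₂) τ ∈ markedIdeal (univ I₁) := by
  choose t ht htm using fun τ : H₂ =>
    h₁.exists_sub_mem (univ I₁) (monomial (τ : Term n) 1)
  let c : H₂ × O → ParamRing K H₁ O ⧸ I₁ := fun p => (t p.1).coeff p.2
  have hc : ∀ τ, markedPoly c τ ∈ markedIdeal (univ I₁) := fun τ => by
    rw [markedPoly, sum_monomial_coeff (ht τ)]
    exact htm τ
  have hle : markedIdeal c ≤ markedIdeal (univ I₁) := markedIdeal_le hc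
  have hz := (h₂.forall_aeval_iff c).2 fun p hp hpc => h₁.eq_zero_of_mem hp (hle hpc)
  refine ⟨Ideal.Quotient.liftₐ I₂ (aeval c) hz, fun τ => ?_⟩
  convert hc τ using 2
  funext p
  exact (Ideal.Quotient.liftₐ_apply I₂ (aeval c) hz _).trans (aeval_X c p)

/-- The composite carries the universal coefficients to those of a marked set that still lies in the
universal ideal, where marked sets are unique. -/
theorem comp_eq_id (h₁ : Represents K I₁)
    {ψ : (ParamRing K H₂ O ⧸ I₂) →ₐ[K] (ParamRing K H₁ O ⧸ I₁)}
    {χ : (ParamRing K H₁ O ⧸ I₁) →ₐ[K] (ParamRing K H₂ O ⧸ I₂)}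
    (hψ : ∀ τ, markedPoly (ψ ∘ univ I₂) τ ∈ markedIdeal (univ I₁))
    (hχ : ∀ τ, markedPoly (χ ∘ univ I₁) τ ∈ markedIdeal (univ I₂)) :
    ψ.comp χ = AlgHom.id K _ := by
  have hle : markedIdeal (ψ ∘ univ I₂) ≤ markedIdeal (univ I₁) := markedIdeal_le hψ
  have h : ψ ∘ χ ∘ univ I₁ = univ I₁ :=
    eq_of_markedPoly_mem (fun f hf hfI => h₁.eq_zero_of_mem hf hfI)
      (fun τ => map_markedPoly ψ.toRingHom (χ ∘ univ I₁) τ ▸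
        hle (map_mem_markedIdeal ψ.toRingHom (hχ τ)))
      (markedPoly_mem _)
  refine Ideal.Quotient.algHom_ext K (MvPolynomial.algHom_ext fun p => ?_)
  exact congrFun h p

/-- Two ideals that represent complements of the same module have isomorphic quotients. -/
theorem nonempty_algEquiv (h₁ : Represents K I₁) (h₂ : Represents K I₂) :
    Nonempty ((ParamRing K H₁ O ⧸ I₁) ≃ₐ[K] (ParamRing K H₂ O ⧸ I₂)) := by
  obtain ⟨ψ, hψ⟩ := h₁.exists_algHom h₂
  obtain ⟨χ, hχ⟩ := h₂.exists_algHom h₁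
  exact ⟨AlgEquiv.ofAlgHom χ ψ (h₂.comp_eq_id hχ hψ) (h₁.comp_eq_id hψ hχ)⟩

end Represents

/-- Isomorphic `K`-algebras have isomorphic spectra over `K`. -/
theorem nonempty_specOver_iso {K S T : Type u} [CommRing K] [CommRing S] [CommRing T]
    [Algebra K S] [Algebra K T] (e : S ≃ₐ[K] T) : Nonempty (specOver K S ≅ specOver K T) := by
  refine ⟨Over.isoMk (Scheme.Spec.mapIso e.toRingEquiv.toCommRingCatIso.symm.op) ?_⟩
  change Spec.map _ ≫ Spec.map _ = Spec.map _
  rw [← Spec.map_comp]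
  congr 1
  ext x
  exact e.symm.commutes x

/-! ### Termination of reduction -/

section Reduction

variable {n : ℕ} {A : Type*} [CommRing A] {O : Finset (Term n)} {J : ReductionStructure n}

theorem ReductionStructure.Step.sub_mem {F : J.head → MvPolynomial (Fin n) A}
    {g h : MvPolynomial (Fin n) A} (hs : J.Step F g h) :
    g - h ∈ Ideal.span (Set.range F) := by
  obtain ⟨γ, -, α, η, -, -, rfl⟩ := hs
  rw [sub_sub_cancel]
  exact Ideal.mul_mem_left _ _ (Ideal.subset_span ⟨α, rfl⟩)

theorem ReductionStructure.Reduces.sub_mem {F : J.head → MvPolynomial (Fin n) A}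
    {g h : MvPolynomial (Fin n) A} (hs : J.Reduces F g h) :
    g - h ∈ Ideal.span (Set.range F) := by
  induction hs with
  | refl => simp
  | tail _ hs ih => simpa using add_mem ih hs.sub_mem

/-- Reduction of the polynomials with support in `L` terminates if each step replaces a term of
`L` by terms of `L` which are in `O` or of smaller weight. -/
theorem exists_reduces {W : Type*} [Preorder W] [WellFoundedLT W]
    (F : J.head → MvPolynomial (Fin n) A)
    (hF : ∀ α : J.head, monomial (α : Term n) 1 - F α ∈ restrictSupport A (O : Set (Term n)))
    (w : Term n → W) (L E : Set (Term n))
    (hL : ∀ γ ∈ L, γ ∉ O → ∃ α : J.head, ∃ η ∈ J.mult α, γ = α + η ∧ η ∈ E ∧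
      ∀ σ ∈ O, η + σ ∈ L ∧ (η + σ ∉ O → w (η + σ) < w γ)) :
    ∀ g ∈ restrictSupport A L, ∃ h ∈ restrictSupport A (O : Set (Term n)), J.Reduces F g h ∧
      g - h ∈ Submodule.span A {p | ∃ η ∈ E, ∃ α, p = monomial η 1 * F α} := by
  classical
  intro g
  -- Terms in `O` are already reduced, so only the weights of the remaining ones are counted,
  -- compared by the Dershowitz–Manna order on multisets.
  let M : MvPolynomial (Fin n) A → Multiset W := fun g => (g.support \ O).val.map w
  induction g using (InvImage.wf M Multiset.wellFounded_isDershowitzMannaLT).induction with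
  | _ g ih =>
    intro hg
    by_cases h0 : ∃ γ ∈ g.support, γ ∉ O
    · obtain ⟨γ, hγ, hγO⟩ := h0
      obtain ⟨α, η, hη, hγη, hηE, hσ⟩ := hL γ ((mem_restrictSupport_iff _).1 hg hγ) hγO
      let g' := g - monomial η (g.coeff γ) * F α
      let t := monomial (α : Term n) 1 - F α
      have hg'eq : g' = g - monomial γ (g.coeff γ) + monomial η (g.coeff γ) * t := by
        simp only [g', t, mul_sub, monomial_mul, mul_one, hγη, add_comm η]
        ring
      have hsupp : ∀ δ ∈ g'.support, (δ ∈ g.support ∧ δ ≠ γ) ∨ ∃ σ ∈ O, δ = η + σ := by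
        intro δ hδ
        by_contra! hcon
        obtain ⟨h1, h2⟩ := hcon
        apply mem_support_iff.1 hδ
        have h3 : (monomial η (g.coeff γ) * t).coeff δ = 0 := by
          rw [coeff_monomial_mul']
          split_ifs with hle
          · have : δ - η ∉ t.support := fun hmem =>
              h2 _ ((mem_restrictSupport_iff _).1 (hF α) hmem) (add_tsub_cancel_of_le hle).symm
            rw [notMem_support_iff.1 this, mul_zero]
          · rfl
        rw [hg'eq, coeff_add, h3, coeff_sub, coeff_monomial, add_zero]
        by_cases hδγ : γ = δ
        · simp [hδγ]
        · rw [if_neg hδγ, sub_zero]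
          by_contra hne
          exact hδγ (h1 (mem_support_iff.2 hne)).symm
      -- The eliminated term cannot return through the tail: it would have weight smaller than
      -- itself.
      have hγ' : γ ∉ g'.support := by
        intro hmem
        rcases hsupp γ hmem with ⟨-, h⟩ | ⟨σ, hσO, h⟩
        · exact h rfl
        · exact lt_irrefl _ (h ▸ (hσ σ hσO).2 (h ▸ hγO))
      have hlt : (M g').IsDershowitzMannaLT (M g) := by
        -- The three multisets are the terms kept, the terms created and the terms removed; each
        -- created term is dominated by `γ`.
        refine ⟨((g.support ∩ g'.support) \ O).val.map w, ((g'.support \ g.support) \ O).val.map w,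
          ((g.support \ g'.support) \ O).val.map w, ?_, ?_, ?_, ?_⟩
        · rw [Ne, Multiset.empty_eq_zero, Multiset.map_eq_zero, Finset.val_eq_zero]
          exact Finset.ne_empty_of_mem (a := γ) (by simp_all)
        · rw [← Multiset.map_add]
          refine congrArg (Multiset.map w) ?_
          rw [← Finset.disjUnion_val _ _ (by
            rw [Finset.disjoint_left]; intro a; simp; tauto)]
          refine congrArg Finset.val ?_
          ext a
          simp
          tauto
        · rw [← Multiset.map_add]
          refine congrArg (Multiset.map w) ?_
          rw [← Finset.disjUnion_val _ _ (by
            rw [Finset.disjoint_left]; intro a; simp; tauto)]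
          refine congrArg Finset.val ?_
          ext a
          simp
          tauto
        · intro y hy
          rw [Multiset.mem_map] at hy
          obtain ⟨δ, hδ, rfl⟩ := hy
          simp only [Finset.mem_val, Finset.mem_sdiff] at hδ
          refine ⟨w γ, Multiset.mem_map_of_mem _ ?_, ?_⟩
          · simp only [Finset.mem_val, Finset.mem_sdiff]
            exact ⟨⟨hγ, hγ'⟩, hγO⟩
          · rcases hsupp δ hδ.1.1 with ⟨h, -⟩ | ⟨σ, hσO, rfl⟩
            · exact absurd h hδ.1.2
            · exact (hσ σ hσO).2 hδ.2
      have hg'L : g' ∈ restrictSupport A L := by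
        rw [mem_restrictSupport_iff]
        intro δ hδ
        rcases hsupp δ hδ with ⟨h, -⟩ | ⟨σ, hσO, rfl⟩
        · exact (mem_restrictSupport_iff _).1 hg h
        · exact (hσ σ hσO).1
      obtain ⟨h, hh, hred, hmem⟩ := ih g' hlt hg'L
      refine ⟨h, hh, Relation.ReflTransGen.head ⟨γ, hγ, α, η, hη, hγη, rfl⟩ hred, ?_⟩
      have hgg' : g - h = g.coeff γ • (monomial η 1 * F α) + (g' - h) := by
        have : monomial η (g.coeff γ) = g.coeff γ • monomial η (1 : A) := by
          rw [smul_monomial, smul_eq_mul, mul_one]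
        simp only [g', this, smul_mul_assoc]
        ring
      rw [hgg']
      exact add_mem (Submodule.smul_mem _ _ (Submodule.subset_span ⟨η, hηE, α, rfl⟩)) hmem
    · push Not at h0
      exact ⟨g, (mem_restrictSupport_iff _).2 fun γ hγ => h0 γ hγ, Relation.ReflTransGen.refl, by simp⟩

end Reduction

/-! ### Specializing the coefficient ideal to a marked set -/

section Criterion

variable {K : Type u} [Field K] {n : ℕ} {O : Finset (Term n)} {J : ReductionStructure n}
  {R : Term n → Term n → Prop} {A : Type u} [CommRing A] [Algebra K A]

theorem sub_markedPoly_mem {H : Finset (Term n)} {A : Type*} [CommRing A] (c : H × O → A)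
    (α : H) :
    monomial (α : Term n) 1 - markedPoly c α ∈ restrictSupport A (O : Set (Term n)) := by
  rw [markedPoly, sub_sub_cancel]
  exact tail_mem c α

theorem map_aeval_sPoly {H : Finset (Term n)} (c : H × O → A) (α α' : H) :
    map ((aeval c : ParamRing K H O →ₐ[K] A) : ParamRing K H O →+* A)
      (sPoly (α : Term n) α' (genericMarkedSet K H O α) (genericMarkedSet K H O α')) =
    sPoly (α : Term n) α' (markedPoly c α) (markedPoly c α') := by
  have h : ∀ τ, map ((aeval c : ParamRing K H O →ₐ[K] A) : ParamRing K H O →+* A)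
      (genericMarkedSet K H O τ) = markedPoly c τ := fun τ => by
    change MvPolynomial.map _ (markedPoly X τ) = _
    rw [map_markedPoly]
    congr 1
    funext p
    simp
  simp [sPoly, h]

theorem map_mem_restrictSupport {A B : Type*} [CommRing A] [CommRing B] (f : A →+* B)
    {L : Set (Term n)} {h : MvPolynomial (Fin n) A} (hh : h ∈ restrictSupport A L) :
    map f h ∈ restrictSupport B L :=
  (mem_restrictSupport_iff _).2
    ((Finset.coe_subset.2 (support_map_subset f h)).trans ((mem_restrictSupport_iff _).1 hh))

theorem sPoly_mem {H : Finset (Term n)} {A : Type*} [CommRing A] (c : H × O → A) (α α' : H) :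
    sPoly (α : Term n) α' (markedPoly c α) (markedPoly c α') ∈ markedIdeal c :=
  sub_mem (Ideal.mul_mem_left _ _ (markedPoly_mem c α))
    (Ideal.mul_mem_left _ _ (markedPoly_mem c α'))

/-- The coefficient ideal vanishes at the marked sets whose ideal meets the module generated by
`O` trivially. -/
theorem aeval_eq_zero_of_mem_coeffIdeal (c : J.head × O → A)
    (hc : ∀ h ∈ restrictSupport A (O : Set (Term n)), h ∈ markedIdeal c → h = 0)
    {p : ParamRing K J.head O} (hp : p ∈ coeffIdeal K O J R) : aeval c p = 0 := by
  suffices h : coeffIdeal K O J R ≤ RingHom.ker (aeval c : ParamRing K J.head O →ₐ[K] A) from h hp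
  refine Ideal.span_le.2 ?_
  rintro _ ⟨α, α', -, h, hred, hh, γ, rfl⟩
  let f : ParamRing K J.head O →+* A := (aeval c : ParamRing K J.head O →ₐ[K] A)
  have hfc : f ∘ X = c := by funext p; simp [f]
  -- Reduction changes a polynomial only by elements of the generic marked ideal, and this survives
  -- specialization.
  have h1 : map f h ∈ markedIdeal c := by
    have := map_mem_markedIdeal f (c := (X : J.head × O → ParamRing K J.head O)) hred.sub_mem
    rw [hfc, map_sub, map_aeval_sPoly] at this
    exact by
      simpa using sub_mem (sPoly_mem c α α') this
  have h2 := hc _ (map_mem_restrictSupport f ((mem_restrictSupport_iff _).2 hh)) h1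
  have h3 := congrArg (coeff γ) h2
  rwa [coeff_map, coeff_zero] at h3

theorem map_eq_zero_of_reduces (c : J.head × O → A)
    (hc : ∀ p ∈ coeffIdeal K O J R, aeval c p = 0) {α α' : J.head} (hR : R α α')
    {h : MvPolynomial (Fin n) (ParamRing K J.head O)}
    (hred : J.Reduces (genericMarkedSet K J.head O)
        (sPoly α α' (genericMarkedSet K J.head O α) (genericMarkedSet K J.head O α')) h)
    (hh : h ∈ restrictSupport _ (O : Set (Term n))) :
    map ((aeval c : ParamRing K J.head O →ₐ[K] A) : ParamRing K J.head O →+* A) h = 0 := by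
  ext γ
  rw [coeff_map, coeff_zero]
  exact hc _ (Ideal.subset_span ⟨α, α', hR, h, hred, (mem_restrictSupport_iff _).1 hh, γ, rfl⟩)

/-- The `S`-polynomials of the couples in `R` lie in the module generated by the multiples used
for their reduction. -/
theorem sPoly_mem_span {W : Type*} [Preorder W] [WellFoundedLT W]
    (c : J.head × O → A) (hc : ∀ p ∈ coeffIdeal K O J R, aeval c p = 0)
    (w : Term n → W) (L E : Set (Term n))
    (hL : ∀ γ ∈ L, γ ∉ O → ∃ α : J.head, ∃ η ∈ J.mult α, γ = α + η ∧ η ∈ E ∧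
      ∀ σ ∈ O, η + σ ∈ L ∧ (η + σ ∉ O → w (η + σ) < w γ))
    {α α' : J.head} (hR : R α α')
    (hS : sPoly (α : Term n) α' (genericMarkedSet K J.head O α) (genericMarkedSet K J.head O α') ∈
      restrictSupport _ L) :
    sPoly (α : Term n) α' (markedPoly c α) (markedPoly c α') ∈
      Submodule.span A {p | ∃ η ∈ E, ∃ α, p = monomial η 1 * markedPoly c α} := by
  obtain ⟨h, hh, hred, hmem⟩ := exists_reduces (genericMarkedSet K J.head O)
    (fun α => sub_markedPoly_mem X α) w L E hL _ hS
  let f : ParamRing K J.head O →+* A := (aeval c : ParamRing K J.head O →ₐ[K] A)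
  have hfc : f ∘ X = c := by funext p; simp [f]
  have h0 : map f h = 0 := map_eq_zero_of_reduces c hc hR hred hh
  -- The reduction takes place over `K[C]`, where the coefficient ideal is defined. Only the
  -- resulting expression is specialized, since reduction steps need not be preserved when
  -- coefficients become zero.
  have key : ∀ p ∈ Submodule.span (ParamRing K J.head O)
      {p | ∃ η ∈ E, ∃ α, p = monomial η 1 * genericMarkedSet K J.head O α},
      map f p ∈ Submodule.span A {p | ∃ η ∈ E, ∃ α, p = monomial η 1 * markedPoly c α} := by
    intro p hp
    induction hp using Submodule.span_induction with
    | mem p hp =>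
      obtain ⟨η, hη, τ, rfl⟩ := hp
      refine Submodule.subset_span ⟨η, hη, τ, ?_⟩
      rw [map_mul, map_monomial, map_one]
      congr 1
      exact (map_markedPoly f X τ).trans (by rw [hfc])
    | zero => simp
    | add p q _ _ hp hq => rw [map_add]; exact add_mem hp hq
    | smul a p _ hp =>
      rw [smul_eq_C_mul, map_mul, map_C, ← smul_eq_C_mul]
      exact Submodule.smul_mem _ _ hp
  have h1 := key _ hmem
  rwa [map_sub, h0, sub_zero, map_aeval_sPoly] at h1

end Criterion

/-! ### Border marked sets and commuting multiplication operators -/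

section Border

variable {n : ℕ} {O : Finset (Term n)}

theorem add_var_mem_border {σ : Term n} (hσ : σ ∈ O) {i : Fin n} (h : var i + σ ∉ O) :
    var i + σ ∈ border O :=
  mem_border.2 ⟨⟨σ, hσ, i, add_comm _ _⟩, h⟩

theorem sup_eq_var_add {i j : Fin n} (hij : i ≠ j) {α α' : Term n}
    (h : var i + α = var j + α') : α ⊔ α' = var i + α := by
  ext k
  have hk := DFunLike.congr_fun h k
  simp only [Finsupp.coe_add, Pi.add_apply, Finsupp.single_apply, Finsupp.sup_apply] at hk ⊢
  split_ifs at hk ⊢ <;> omega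

/-- This is where the ordering by degree enters: a later border term dividing an earlier one has at
least its degree, hence equals it. -/
theorem zero_mem_borderMult {β : Fin (border O).card ≃ border O}
    (hβ : Monotone fun i => (β i : Term n).degree) (b : Term n) : 0 ∈ borderMult O β b := by
  rintro i j rfl hij hle
  rw [add_zero] at hle
  have h1 := add_tsub_cancel_of_le hle
  have h2 := congrArg Finsupp.degree h1
  have h3 : (β i : Term n).degree ≤ (β j : Term n).degree := hβ hij.le
  rw [map_add] at h2
  have h4 : ((β i : Term n) - β j).degree = 0 := by omega
  rw [(Finsupp.degree_eq_zero_iff _).1 h4, add_zero] at h1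
  exact hij.ne' (β.injective (Subtype.ext h1))

section Coordinates

variable {A : Type*} [CommRing A] (c : border O × O → A)

open Classical in
/-- The coordinates of the normal form of a term of `O` or of its border. -/
def termCoord (γ : Term n) : O → A :=
  if h : γ ∈ O then Pi.single ⟨γ, h⟩ 1
  else if h : γ ∈ border O then fun σ => c (⟨γ, h⟩, σ) else 0

/-- The coordinates of the normal form of a polynomial supported in `O` and its border. -/
def polyCoord : MvPolynomial (Fin n) A →ₗ[A] (O → A) :=
  (basisMonomials (Fin n) A).constr A (termCoord c)

/-- The polynomial supported in `O` with given coefficients. -/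
def ofCoord : (O → A) →ₗ[A] MvPolynomial (Fin n) A :=
  ∑ σ : O, monomial (σ : Term n) ∘ₗ LinearMap.proj σ

/-- The `i`-th formal multiplication operator of a border marked set. -/
def mulOp (i : Fin n) : Module.End A (O → A) :=
  polyCoord c ∘ₗ LinearMap.mulLeft A (X i) ∘ₗ ofCoord

theorem ofCoord_apply (m : O → A) : ofCoord m = ∑ σ : O, monomial (σ : Term n) (m σ) := by
  simp [ofCoord]

theorem polyCoord_monomial (γ : Term n) : polyCoord c (monomial γ 1) = termCoord c γ := by
  have := (basisMonomials (Fin n) A).constr_basis A (termCoord c) γ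
  rwa [coe_basisMonomials] at this

open Classical in
theorem termCoord_of_mem {γ : Term n} (h : γ ∈ O) : termCoord c γ = Pi.single ⟨γ, h⟩ 1 := by
  rw [termCoord, dif_pos h]

theorem termCoord_border (α : border O) : termCoord c α = fun σ => c (α, σ) := by
  rw [termCoord, dif_neg (mem_border.1 α.2).2, dif_pos α.2]

theorem ofCoord_termCoord {γ : Term n} (h : γ ∈ O) :
    ofCoord (termCoord c γ) = monomial γ 1 := by
  classical
  rw [termCoord_of_mem c h, ofCoord_apply, Finset.sum_eq_single ⟨γ, h⟩]
  · simp
  · intro σ _ hσ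
    simp [hσ]
  · simp

theorem ofCoord_termCoord_border (α : border O) :
    ofCoord (termCoord c α) = monomial (α : Term n) 1 - markedPoly c α := by
  rw [termCoord_border, ofCoord_apply, markedPoly, sub_sub_cancel]

theorem ofCoord_polyCoord {p : MvPolynomial (Fin n) A}
    (hp : p ∈ restrictSupport A (O : Set (Term n))) : ofCoord (polyCoord c p) = p := by
  rw [restrictSupport_eq_span] at hp
  induction hp using Submodule.span_induction with
  | mem p hp =>
    obtain ⟨σ, hσ, rfl⟩ := hp
    rw [polyCoord_monomial, ofCoord_termCoord c hσ]
  | zero => simp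
  | add p q _ _ hp hq => rw [map_add, map_add, hp, hq]
  | smul a p _ hp => rw [map_smul, map_smul, hp]

theorem polyCoord_ofCoord (m : O → A) : polyCoord c (ofCoord m) = m := by
  classical
  have h : polyCoord c ∘ₗ ofCoord = LinearMap.id := by
    refine (Pi.basisFun A O).ext fun σ => ?_
    have := termCoord_of_mem c σ.2
    rw [Pi.basisFun_apply, LinearMap.comp_apply, ← this, ofCoord_termCoord c σ.2,
      polyCoord_monomial, LinearMap.id_apply]
  exact LinearMap.congr_fun h m

theorem polyCoord_markedPoly (α : border O) : polyCoord c (markedPoly c α) = 0 := by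
  have h : markedPoly c α = monomial (α : Term n) 1 - ofCoord (termCoord c α) := by
    rw [ofCoord_termCoord_border, sub_sub_cancel]
  rw [h, map_sub, polyCoord_monomial, polyCoord_ofCoord, sub_self]

theorem mulOp_apply (i : Fin n) (m : O → A) :
    mulOp c i m = polyCoord c (X i * ofCoord m) := rfl

theorem mulOp_termCoord {γ : Term n} (h : γ ∈ O) (i : Fin n) :
    mulOp c i (termCoord c γ) = termCoord c (var i + γ) := by
  rw [mulOp_apply, ofCoord_termCoord c h, X, monomial_mul, one_mul, polyCoord_monomial]

/-- The heads cancel, so an S-polynomial involves only multiples of the two tails. -/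
theorem sPoly_markedPoly {H : Finset (Term n)} (c : H × O → A) (α α' : H) :
    sPoly (α : Term n) α' (markedPoly c α) (markedPoly c α') =
      monomial ((α ⊔ α' : Term n) - α' : Term n) 1 * (monomial (α' : Term n) 1 - markedPoly c α') -
      monomial ((α ⊔ α' : Term n) - α : Term n) 1 * (monomial (α : Term n) 1 - markedPoly c α) := by
  have h1 : (α : Term n) ⊔ α' - α' + α' = (α : Term n) ⊔ α' := tsub_add_cancel_of_le le_sup_right
  have h2 : (α : Term n) ⊔ α' - α + α = (α : Term n) ⊔ α' := tsub_add_cancel_of_le le_sup_left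
  rw [sPoly, mul_sub, mul_sub, monomial_mul, monomial_mul, h1, h2]
  ring

theorem sPoly_eq_of_eq_var_add {i : Fin n} {α α' : border O} (h : (α : Term n) = var i + α') :
    sPoly (α : Term n) α' (markedPoly c α) (markedPoly c α') =
      X i * ofCoord (termCoord c α') - ofCoord (termCoord c α) := by
  have hle : (α' : Term n) ≤ α := h ▸ le_add_self
  rw [sPoly_markedPoly, sup_of_le_left hle, tsub_self, ofCoord_termCoord_border,
    ofCoord_termCoord_border, h, add_tsub_cancel_right, X,
    show (monomial 0 1 : MvPolynomial (Fin n) A) = 1 from rfl, one_mul]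

theorem sPoly_eq_of_var_add_eq {i j : Fin n} (hij : i ≠ j) {α α' : border O}
    (h : var i + (α : Term n) = var j + α') :
    sPoly (α : Term n) α' (markedPoly c α) (markedPoly c α') =
      X j * ofCoord (termCoord c α') - X i * ofCoord (termCoord c α) := by
  have hsup := sup_eq_var_add hij h
  rw [sPoly_markedPoly, hsup, add_tsub_cancel_right, h, add_tsub_cancel_right,
    ofCoord_termCoord_border, ofCoord_termCoord_border, X, X]

theorem ofCoord_mem (m : O → A) : ofCoord m ∈ restrictSupport A (O : Set (Term n)) := by
  rw [ofCoord_apply]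
  exact sum_mem fun σ _ => (monomial_mem_restrictSupport _).2 (Or.inl σ.2)

theorem X_mul_mem {p : MvPolynomial (Fin n) A}
    (hp : p ∈ restrictSupport A (O : Set (Term n))) (i : Fin n) :
    X i * p ∈ restrictSupport A ((O : Set (Term n)) ∪ border O) := by
  rw [restrictSupport_eq_span] at hp
  induction hp using Submodule.span_induction with
  | mem p hp =>
    obtain ⟨σ, hσ, rfl⟩ := hp
    rw [X, monomial_mul, monomial_mem_restrictSupport]
    by_cases h : var i + σ ∈ O
    · exact Or.inl (Or.inl h)
    · exact Or.inl (Or.inr (add_var_mem_border hσ h))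
  | zero => simp
  | add p q _ _ hp hq => rw [mul_add]; exact add_mem hp hq
  | smul a p _ hp => rw [mul_smul_comm]; exact Submodule.smul_mem _ _ hp

theorem sPoly_mem_of_isNeighbour {α α' : border O} (h : IsNeighbour (α : Term n) α') :
    sPoly (α : Term n) α' (markedPoly c α) (markedPoly c α') ∈
      restrictSupport A ((O : Set (Term n)) ∪ border O) := by
  obtain ⟨i, h⟩ | ⟨i, j, h⟩ := h
  · rw [sPoly_eq_of_eq_var_add c h]
    exact sub_mem (X_mul_mem (ofCoord_mem _) _)
      (restrictSupport_mono A Set.subset_union_left (ofCoord_mem _))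
  · by_cases hij : i = j
    · subst hij
      have : α = α' := Subtype.ext (add_left_cancel h)
      subst this
      simp [sPoly]
    · rw [sPoly_eq_of_var_add_eq c hij h]
      exact sub_mem (X_mul_mem (ofCoord_mem _) _) (X_mul_mem (ofCoord_mem _) _)

/-- Commuting endomorphisms define a polynomial functional calculus. -/
theorem exists_algHom_of_commute {ι M : Type*} [AddCommGroup M] [Module A M]
    (T : ι → Module.End A M) (hT : ∀ i j, T i * T j = T j * T i) :
    ∃ P : MvPolynomial ι A →ₐ[A] Module.End A M, ∀ i, P (X i) = T i := by
  -- Evaluation of polynomials needs a commutative target; the subalgebra generated by the operators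
  -- serves.
  have : IsMulCommutative (Algebra.adjoin A (Set.range T)) :=
    Algebra.isMulCommutative_adjoin A (by
      rintro _ ⟨i, rfl⟩ _ ⟨j, rfl⟩
      exact hT i j)
  let : CommRing (Algebra.adjoin A (Set.range T)) :=
    { (inferInstance : Ring (Algebra.adjoin A (Set.range T))) with
      mul_comm := this.is_comm.comm }
  let f : MvPolynomial ι A →ₐ[A] Algebra.adjoin A (Set.range T) :=
    aeval fun i => ⟨T i, Algebra.subset_adjoin ⟨i, rfl⟩⟩
  refine ⟨(Algebra.adjoin A (Set.range T)).val.comp f, fun i => ?_⟩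
  rw [AlgHom.comp_apply, aeval_X]
  rfl

variable {c}

/-- On the basis vector of `σ`, the case where both `x_i σ` and `x_j σ` lie in `O` is formal. If
just one does, the couple `x_i x_j σ`, `x_j σ` (or its mirror) gives the equality; if neither does,
the couple `x_i σ`, `x_j σ` gives it. -/
theorem mulOp_mul_comm (hO : IsOrderIdeal (O : Set (Term n)))
    (hS : ∀ α α' : border O, IsNeighbour (α : Term n) α' →
      polyCoord c (sPoly (α : Term n) α' (markedPoly c α) (markedPoly c α')) = 0)
    (i j : Fin n) : mulOp c i * mulOp c j = mulOp c j * mulOp c i := by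
  classical
  have hb : ∀ (i : Fin n) (γ : Term n), γ ∈ border O → var i + γ ∈ border O →
      mulOp c i (termCoord c γ) = termCoord c (var i + γ) := by
    intro i γ h1 h2
    have h := hS ⟨_, h2⟩ ⟨γ, h1⟩ (Or.inl ⟨i, rfl⟩)
    rw [sPoly_eq_of_eq_var_add c rfl, map_sub, polyCoord_ofCoord] at h
    exact sub_eq_zero.1 h
  refine (Pi.basisFun A O).ext fun σ => ?_
  rw [Pi.basisFun_apply, Module.End.mul_apply, Module.End.mul_apply,
    ← termCoord_of_mem c σ.2, mulOp_termCoord c σ.2, mulOp_termCoord c σ.2]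
  have hcomm : var i + (var j + (σ : Term n)) = var j + (var i + σ) := add_left_comm _ _ _
  have key : ∀ i j : Fin n, var i + (σ : Term n) ∈ O → var j + (σ : Term n) ∉ O →
      mulOp c i (termCoord c (var j + σ)) = mulOp c j (termCoord c (var i + σ)) := by
    intro i j hi hj
    have hcomm : var i + (var j + (σ : Term n)) = var j + (var i + σ) := add_left_comm _ _ _
    have hjb := add_var_mem_border σ.2 hj
    have hji : var j + (var i + (σ : Term n)) ∉ O := fun h =>
      hj (hO _ _ h (hcomm ▸ le_add_self))
    rw [hb i _ hjb (hcomm ▸ add_var_mem_border hi hji), mulOp_termCoord c hi, hcomm]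
  by_cases hi : var i + (σ : Term n) ∈ O <;> by_cases hj : var j + (σ : Term n) ∈ O
  · rw [mulOp_termCoord c hi, mulOp_termCoord c hj, hcomm]
  · exact key i j hi hj
  · exact (key j i hj hi).symm
  · by_cases hij : i = j
    · rw [hij]
    · have h := hS ⟨_, add_var_mem_border σ.2 hi⟩ ⟨_, add_var_mem_border σ.2 hj⟩
        (Or.inr ⟨j, i, hcomm.symm⟩)
      rw [sPoly_eq_of_var_add_eq c (Ne.symm hij) hcomm.symm, map_sub] at h
      exact sub_eq_zero.1 h

/-- If the neighbour `S`-polynomials have zero normal form, then the ideal generated by a border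
marked set meets the module generated by `O` trivially. -/
theorem eq_zero_of_mem_markedIdeal_border (hO : IsOrderIdeal (O : Set (Term n)))
    (hS : ∀ α α' : border O, IsNeighbour (α : Term n) α' →
      polyCoord c (sPoly (α : Term n) α' (markedPoly c α) (markedPoly c α')) = 0)
    {h : MvPolynomial (Fin n) A} (hh : h ∈ restrictSupport A (O : Set (Term n)))
    (hI : h ∈ markedIdeal c) : h = 0 := by
  obtain ⟨P, hP⟩ := exists_algHom_of_commute (mulOp c) (mulOp_mul_comm hO hS)
  let v := termCoord c 0
  have hX : ∀ (i : Fin n) (p : MvPolynomial (Fin n) A), P (X i * p) v = mulOp c i (P p v) := by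
    intro i p
    rw [map_mul, hP, Module.End.mul_apply]
  have hvar : ∀ (i : Fin n) (σ : Term n),
      (monomial (var i + σ) (1 : A)) = X i * monomial σ 1 := by
    intro i σ
    rw [X, monomial_mul, one_mul]
  -- The vector of `1` is cyclic: since `O` is closed under divisors, each term of `O` is reached
  -- from `1` by variables without leaving `O`.
  have hterm : ∀ σ : Term n, σ ∈ O → P (monomial σ 1) v = termCoord c σ := by
    intro σ
    induction σ using WellFoundedLT.induction with
    | _ σ ih =>
      intro hσ
      by_cases hz : σ = 0
      · subst hz
        have : P (monomial 0 1) = 1 := map_one P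
        rw [this, Module.End.one_apply]
      · obtain ⟨i, hi⟩ := Finsupp.support_nonempty_iff.2 hz
        have hsub := sub_var_add hi
        rw [add_comm] at hsub
        have hmem : σ - var i ∈ O := hO _ _ hσ tsub_le_self
        have hlt : σ - var i < σ := by
          refine lt_of_le_of_ne tsub_le_self fun he => ?_
          rw [he] at hsub
          have := DFunLike.congr_fun hsub i
          simp at this
        rw [← hsub, hvar, hX, ih _ hlt hmem, mulOp_termCoord c hmem]
  have hpoly : ∀ p ∈ restrictSupport A (O : Set (Term n)), P p v = polyCoord c p := by
    intro p hp
    rw [restrictSupport_eq_span] at hp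
    induction hp using Submodule.span_induction with
    | mem p hp =>
      obtain ⟨σ, hσ, rfl⟩ := hp
      rw [polyCoord_monomial, hterm σ hσ]
    | zero => simp
    | add p q _ _ hp hq => rw [map_add, map_add, LinearMap.add_apply, hp, hq]
    | smul a p _ hp => rw [map_smul, map_smul, LinearMap.smul_apply, hp]
  have hmarked : ∀ α, P (markedPoly c α) v = 0 := by
    intro α
    -- Writing the head as `x_i σ` with `σ ∈ O`, its action on `v` is by construction the coordinate
    -- vector of the tail.
    obtain ⟨⟨σ, hσ, i, hα⟩, -⟩ := mem_border.1 α.2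
    rw [add_comm] at hα
    have h1 : markedPoly c α = monomial (α : Term n) 1 - ofCoord (termCoord c α) := by
      rw [ofCoord_termCoord_border, sub_sub_cancel]
    rw [h1, map_sub, LinearMap.sub_apply, hpoly _ (ofCoord_mem _), polyCoord_ofCoord, hα, hvar,
      hX, hterm σ hσ, mulOp_termCoord c hσ, sub_self]
  have hker : ∀ p ∈ markedIdeal c, P p v = 0 := by
    intro p hp
    induction hp using Submodule.span_induction with
    | mem p hp =>
      obtain ⟨α, rfl⟩ := hp
      exact hmarked α
    | zero => simp
    | add p q _ _ hp hq => rw [map_add, LinearMap.add_apply, hp, hq, add_zero]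
    | smul a p _ hp => rw [smul_eq_mul, map_mul, Module.End.mul_apply, hp, map_zero]
  rw [← ofCoord_polyCoord c hh, ← hpoly h hh, hker h hI, map_zero]

/-- The sum of `⟨O⟩` and the marked ideal contains the constants and is stable under each variable,
because `x_i σ` is in `O` or is a head. -/
theorem exists_sub_mem_markedIdeal_border (h0 : (0 : Term n) ∈ O) (c : border O × O → A)
    (p : MvPolynomial (Fin n) A) :
    ∃ h ∈ restrictSupport A (O : Set (Term n)), p - h ∈ markedIdeal c := by
  let N := restrictSupport A (O : Set (Term n)) ⊔ (markedIdeal c).restrictScalars A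
  have hX : ∀ (i : Fin n), ∀ h ∈ restrictSupport A (O : Set (Term n)), h * X i ∈ N := by
    intro i h hh
    rw [restrictSupport_eq_span] at hh
    induction hh using Submodule.span_induction with
    | mem p hp =>
      obtain ⟨σ, hσ, rfl⟩ := hp
      rw [mul_comm, X, monomial_mul, one_mul]
      by_cases hO : var i + σ ∈ O
      · exact Submodule.mem_sup_left ((monomial_mem_restrictSupport _).2 (Or.inl hO))
      · let α : border O := ⟨_, add_var_mem_border hσ hO⟩
        rw [← sub_add_cancel (monomial (var i + σ) (1 : A)) (markedPoly c α)]
        exact add_mem (Submodule.mem_sup_left (sub_markedPoly_mem c α))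
          (Submodule.mem_sup_right (markedPoly_mem c α))
    | zero => simp
    | add p q _ _ hp hq => rw [add_mul]; exact add_mem hp hq
    | smul a p _ hp => rw [smul_mul_assoc]; exact Submodule.smul_mem _ _ hp
  have hN : p ∈ N := by
    induction p using MvPolynomial.induction_on with
    | C a => exact Submodule.mem_sup_left ((monomial_mem_restrictSupport _).2 (Or.inl h0))
    | add p q hp hq => exact add_mem hp hq
    | mul_X p i hp =>
      obtain ⟨h, hh, q, hq, rfl⟩ := Submodule.mem_sup.1 hp
      rw [add_mul]
      exact add_mem (hX i h hh) (Submodule.mem_sup_right (Ideal.mul_mem_right _ _ hq))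
  obtain ⟨h, hh, q, hq, rfl⟩ := Submodule.mem_sup.1 hN
  exact ⟨h, hh, by simpa using hq⟩

end Coordinates

/-- The ideal of the border marked scheme represents the complements of the module generated by
`O`. -/
theorem represents_borderIdeal (K : Type u) [Field K] (h0 : (0 : Term n) ∈ O)
    (hO : IsOrderIdeal (O : Set (Term n))) (β : Fin (border O).card ≃ border O)
    (hβ : Monotone fun i => (β i : Term n).degree) : Represents K (borderIdeal K O hO β) where
  exists_sub_mem := exists_sub_mem_markedIdeal_border h0
  forall_aeval_iff {A} _ _ c := by
    refine ⟨fun hc h hh hI => eq_zero_of_mem_markedIdeal_border hO (fun α α' hR => ?_) hh hI,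
      fun hc p hp => aeval_eq_zero_of_mem_coeffIdeal (J := borderRS O hO β) c hc hp⟩
    have hmem := sPoly_mem_span (J := borderRS O hO β) (R := IsNeighbour) c hc
      -- Only the multiplier `1` occurs and a border term is replaced by terms of `O` at once, so
      -- any constant weight will do.
      (fun _ => (0 : ℕ)) ((O : Set (Term n)) ∪ border O) {0} (by
        intro γ hγ hγO
        refine ⟨⟨γ, hγ.resolve_left hγO⟩, 0, zero_mem_borderMult hβ γ, (add_zero γ).symm, rfl, ?_⟩
        intro σ hσ
        rw [zero_add]
        exact ⟨Or.inl hσ, fun h => absurd hσ h⟩)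
      (α := α) (α' := α') hR (sPoly_mem_of_isNeighbour X hR)
    refine Submodule.span_induction (p := fun q _ => polyCoord c q = 0) ?_ ?_ ?_ ?_ hmem
    · rintro _ ⟨η, rfl, τ, rfl⟩
      have : (monomial 0 1 : MvPolynomial (Fin n) A) = 1 := rfl
      rw [this, one_mul]
      exact polyCoord_markedPoly c τ
    · exact map_zero _
    · intro p q _ _ hp hq
      rw [map_add, hp, hq, add_zero]
    · intro a p _ hp
      rw [map_smul, hp, smul_zero]

end Border

/-! ### Pommaret marked sets and the colexicographic order -/

section Pommaret

variable {n : ℕ} {O : Finset (Term n)}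

/-- The multiplier in a Pommaret decomposition of `σ η` is smaller than `η`, unless the head term
divides `σ`. -/
theorem toColex_lt_of_add_eq {σ η α' η' : Term n} (h : σ + η = α' + η')
    (hη' : η' ∈ pommaretMult α') (hle : ¬ α' ≤ σ) : toColex η' < toColex η := by
  by_contra hlt
  rcases (not_lt.1 hlt).eq_or_lt with heq | hlt
  · rw [toColex_inj.1 heq] at h
    exact hle (add_right_cancel h).ge
  -- At the largest variable `t` where the multipliers differ, `η'` has the larger exponent. As `t`
  -- is multiplicative for `α'`, no smaller variable divides `α'`, and comparing exponents gives `α'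
  -- ∣ σ`.
  · obtain ⟨t, h1, h2⟩ := Finsupp.Colex.lt_iff.1 hlt
    refine hle fun i => ?_
    have hi := DFunLike.congr_fun h i
    simp only [Finsupp.coe_add, Pi.add_apply, ofColex_toColex] at hi h1 h2
    rcases lt_trichotomy i t with hit | rfl | hit
    · have : α' i = 0 := by
        by_contra hne
        have ht : t ∈ η'.support := Finsupp.mem_support_iff.2 (by omega)
        exact absurd (hη' t ht i (Finsupp.mem_support_iff.2 hne)) (not_le.2 hit)
      omega
    · omega
    · have := h1 i hit
      omega

/-- Let `x_k = min α'`. Since `α' / x_k ∈ O` and `α ∉ O`, the exponents of `x_k` in `α` and `α'`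
agree. Any other variable where they differ divides both `η` and `α'`, so it is at most and at least
`x_k`. -/
theorem eq_of_le_of_mem_pommaretBasis (hO : IsOrderIdeal (O : Set (Term n))) {α η α' η' : Term n}
    (hα : α ∈ pommaretBasis O) (hα' : α' ∈ pommaretBasis O) (hη : η ∈ pommaretMult α)
    (h : α + η = α' + η') (hle : α ≤ α') : α = α' := by
  by_contra hne
  have h0 : α' ≠ 0 := by
    rintro rfl
    exact hne (le_antisymm hle zero_le)
  obtain ⟨k, hk⟩ := exists_isLeast_support h0
  have hkO := (mem_pommaretBasis.1 hα').2 k hk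
  have hk' : α' k ≠ 0 := Finsupp.mem_support_iff.1 (Finset.mem_coe.1 hk.1)
  have hαk : k ∈ α.support := by
    by_contra hαk
    have hαk := Finsupp.notMem_support_iff.1 hαk
    refine (mem_pommaretBasis.1 hα).1 (hO _ _ hkO fun i => ?_)
    have := hle i
    rw [Finsupp.tsub_apply, Finsupp.single_apply]
    split_ifs with hi
    · subst hi; omega
    · omega
  have hαk' : α k = α' k := by
    by_contra hlt
    refine (mem_pommaretBasis.1 hα).1 (hO _ _ hkO fun i => ?_)
    have := hle i
    rw [Finsupp.tsub_apply, Finsupp.single_apply]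
    split_ifs with hi
    · subst hi; omega
    · omega
  obtain ⟨i, hi⟩ : ∃ i, α i ≠ α' i := by
    by_contra! hall
    exact hne (Finsupp.ext hall)
  have hlt := hle i
  have hsum := DFunLike.congr_fun h i
  simp only [Finsupp.coe_add, Pi.add_apply] at hsum
  have h1 : i ≤ k := hη i (Finsupp.mem_support_iff.2 (by omega)) k hαk
  have h2 : k ≤ i := hk.2 (Finset.mem_coe.2 (Finsupp.mem_support_iff.2 (by omega)))
  exact hi (le_antisymm h1 h2 ▸ hαk')

/-- If neither head divides the other, each multiplier would be strictly smaller than the other. -/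
theorem pommaret_decomposition_unique (hO : IsOrderIdeal (O : Set (Term n))) {α η α' η' : Term n}
    (hα : α ∈ pommaretBasis O) (hα' : α' ∈ pommaretBasis O) (hη : η ∈ pommaretMult α)
    (hη' : η' ∈ pommaretMult α') (h : α + η = α' + η') : α = α' := by
  by_cases h1 : α ≤ α'
  · exact eq_of_le_of_mem_pommaretBasis hO hα hα' hη h h1
  · by_cases h2 : α' ≤ α
    · exact (eq_of_le_of_mem_pommaretBasis hO hα' hα hη' h.symm h2).symm
    · exact absurd (toColex_lt_of_add_eq h hη' h2) (toColex_lt_of_add_eq h.symm hη h1).not_gt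

/-- If `α'` divided `α`, uniqueness of decompositions would force `α' = α` and make `x_i`
multiplicative. Hence `δ` is smaller than `x_i`, and the lcm is all of `x_i α`. -/
theorem exists_nonMult (hO : IsOrderIdeal (O : Set (Term n))) {α : Term n}
    (hα : α ∈ pommaretBasis O) {i : Fin n} (hi : var i ∉ pommaretMult α) :
    ∃ α' ∈ pommaretBasis O, ∃ δ ∈ pommaretMult α', var i + α = α' + δ ∧
      toColex δ < toColex (var i) ∧ α ⊔ α' = var i + α := by
  have hmem : var i + α ∉ O := fun h => (mem_pommaretBasis.1 hα).1 (hO _ _ h le_add_self)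
  obtain ⟨α', hα', δ, hδ, h⟩ := exists_mem_cone_pommaret O _ _ rfl hmem
  have hle : ¬ α' ≤ α := by
    intro hle
    obtain ⟨ρ, rfl⟩ := exists_add_of_le hle
    have hδ' : δ = var i + ρ := by
      rw [add_left_comm] at h
      exact (add_left_cancel h).symm
    have hρ : ρ ∈ pommaretMult α' := fun k hk => hδ k (by
      rw [hδ', Finsupp.mem_support_iff, Finsupp.add_apply]
      have := Finsupp.mem_support_iff.1 hk
      omega)
    have heq := pommaret_decomposition_unique (η := 0) (η' := ρ) hO hα hα'
      (by simp [pommaretMult]) hρ (add_zero _)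
    have hρ0 : ρ = 0 := by simpa using heq
    subst hρ0
    rw [add_zero] at hδ' hi
    exact hi (hδ' ▸ hδ)
  refine ⟨α', hα', δ, hδ, h, ?_, ?_⟩
  · exact toColex_lt_of_add_eq (by rw [← h, add_comm]) hδ hle
  · have hk : ∀ k, α' k ≤ (var i + α) k := fun k => by
      rw [h, Finsupp.add_apply]
      exact Nat.le_add_right _ _
    have hi' : α i < α' i := by
      by_contra hcon
      refine hle fun k => ?_
      have := hk k
      rw [Finsupp.add_apply, Finsupp.single_apply] at this
      split_ifs at this with hik
      · subst hik; omega
      · omega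
    ext k
    have := hk k
    rw [Finsupp.sup_apply]
    rw [Finsupp.add_apply, Finsupp.single_apply] at this ⊢
    split_ifs at this ⊢ with hik
    · subst hik; omega
    · omega

theorem exists_pommaretWeight (O : Finset (Term n)) :
    ∃ w : Term n → Colex (Term n), ∀ γ, γ ∉ O →
      ∃ α ∈ pommaretBasis O, ∃ η ∈ pommaretMult α, γ = α + η ∧ w γ = toColex η := by
  classical
  choose α hα η hη h using fun γ : {γ // γ ∉ O} => exists_mem_cone_pommaret O _ γ.1 rfl γ.2
  refine ⟨fun γ => if hγ : γ ∉ O then toColex (η ⟨γ, hγ⟩) else 0, fun γ hγ => ?_⟩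
  exact ⟨_, hα ⟨γ, hγ⟩, _, hη ⟨γ, hγ⟩, h ⟨γ, hγ⟩, dif_pos hγ⟩

section Marked

variable {A : Type*} [CommRing A] {c : pommaretBasis O × O → A}

theorem exists_sub_mem_markedIdeal_pommaret (hO : IsOrderIdeal (O : Set (Term n)))
    (c : pommaretBasis O × O → A) (p : MvPolynomial (Fin n) A) :
    ∃ h ∈ restrictSupport A (O : Set (Term n)), p - h ∈ markedIdeal c := by
  obtain ⟨w, hw⟩ := exists_pommaretWeight O
  obtain ⟨h, hh, -, hmem⟩ := exists_reduces (J := pommaretRS O hO) (markedPoly c)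
    (sub_markedPoly_mem c) w Set.univ Set.univ (by
      intro γ _ hγ
      obtain ⟨α, hα, η, hη, hγη, hwγ⟩ := hw γ hγ
      refine ⟨⟨α, hα⟩, η, hη, hγη, trivial, fun σ hσ => ⟨trivial, fun hO' => ?_⟩⟩
      obtain ⟨α', hα', η', hη', h, hw'⟩ := hw _ hO'
      rw [hwγ, hw']
      exact toColex_lt_of_add_eq ((add_comm _ _).trans h) hη' fun hle =>
        (mem_pommaretBasis.1 hα').1 (hO _ _ hσ hle))
    p (by rw [restrictSupport_univ]; trivial)
  refine ⟨h, hh, ?_⟩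
  refine Submodule.span_le (p := (markedIdeal c).restrictScalars A).2 ?_ hmem
  rintro _ ⟨η, -, α, rfl⟩
  exact Ideal.mul_mem_left _ _ (markedPoly_mem c α)

/-- The multiplicative multiples of a Pommaret marked set. -/
def multSpan (c : pommaretBasis O × O → A) : Submodule A (MvPolynomial (Fin n) A) :=
  Submodule.span A (Set.range fun x : {x : pommaretBasis O × Term n // x.2 ∈ pommaretMult x.1.1} =>
    monomial x.1.2 1 * markedPoly c x.1.1)

/-- In a nontrivial combination, take a multiple `η g_α` with colex-largest `η`. Its head `αη` lies
outside `O` and cannot cancel: other heads differ by uniqueness, and a tail term `η'σ` equal to it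
would require `η' > η`. -/
theorem eq_zero_of_mem_multSpan (hO : IsOrderIdeal (O : Set (Term n)))
    {v : MvPolynomial (Fin n) A} (hv : v ∈ restrictSupport A (O : Set (Term n)))
    (hV : v ∈ multSpan c) : v = 0 := by
  classical
  obtain ⟨a, rfl⟩ := Finsupp.mem_span_range_iff_exists_finsupp.1 hV
  by_cases h0 : a = 0
  · simp [h0]
  exfalso
  obtain ⟨x, hx, hmax⟩ := Finset.exists_max_image a.support (fun y => toColex y.1.2)
    (Finsupp.support_nonempty_iff.2 h0)
  obtain ⟨⟨⟨α, hα⟩, η⟩, hη⟩ := x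
  have hγ : α + η ∉ O := fun h => (mem_pommaretBasis.1 hα).1 (hO _ _ h le_self_add)
  have hcoeff : ∀ y ∈ a.support, coeff (α + η) (monomial y.1.2 1 * markedPoly c y.1.1) =
      if y = ⟨⟨⟨α, hα⟩, η⟩, hη⟩ then 1 else 0 := by
    rintro ⟨⟨⟨α', hα'⟩, η'⟩, hη'⟩ hy
    have htail : coeff (α + η) (monomial η' 1 * ∑ σ : O, monomial (σ : Term n)
        (c (⟨α', hα'⟩, σ))) = 0 := by
      rw [Finset.mul_sum, coeff_sum]
      refine Finset.sum_eq_zero fun σ _ => ?_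
      rw [monomial_mul, coeff_monomial, if_neg]
      intro h
      refine absurd (hmax _ hy) (not_le.2 (toColex_lt_of_add_eq ((add_comm _ _).trans h) hη ?_))
      exact fun hle => (mem_pommaretBasis.1 hα).1 (hO _ _ σ.2 hle)
    change coeff (α + η) (monomial η' 1 * (monomial α' 1 - _)) = _
    rw [mul_sub, coeff_sub, htail, sub_zero, monomial_mul, one_mul, coeff_monomial]
    refine if_congr ⟨fun h => ?_, fun h => ?_⟩ rfl rfl
    · have h1 := pommaret_decomposition_unique hO hα' hα hη' hη ((add_comm _ _).trans h)
      subst h1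
      have h2 : η' = η := by rw [add_comm] at h; exact add_left_cancel h
      subst h2
      rfl
    · simp only [Subtype.mk.injEq, Prod.mk.injEq] at h
      rw [h.1, h.2, add_comm]
  have hsum : coeff (α + η) (a.sum fun y b => b • (monomial y.1.2 1 * markedPoly c y.1.1)) =
      a ⟨⟨⟨α, hα⟩, η⟩, hη⟩ := by
    rw [Finsupp.sum, coeff_sum, Finset.sum_eq_single_of_mem _ hx]
    · rw [coeff_smul, hcoeff _ hx, if_pos rfl, smul_eq_mul, mul_one]
    · intro y hy hne
      rw [coeff_smul, hcoeff _ hy, if_neg hne, smul_zero]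
  refine Finsupp.mem_support_iff.1 hx ?_
  rw [← hsum]
  exact notMem_support_iff.1 fun h => hγ ((mem_restrictSupport_iff _).1 hv h)

/-- Well-founded induction on `η`: split off a non-multiplicative variable `x_i` and rewrite `x_i
g_α` with multipliers below `x_i`. The order is compatible with products, so all new multipliers are
below `η`. -/
theorem monomial_mul_markedPoly_mem_multSpan
    (hc : ∀ (α : pommaretBasis O) (i : Fin n), var i ∉ pommaretMult (α : Term n) →
      monomial (var i) 1 * markedPoly c α ∈ Submodule.span A
        {p | ∃ η ∈ {η : Term n | toColex η < toColex (var i)}, ∃ α,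
          p = monomial η 1 * markedPoly c α}) (η : Term n) (α : pommaretBasis O) :
    monomial η 1 * markedPoly c α ∈ multSpan c := by
  obtain ⟨η, rfl⟩ := ofColex.surjective η
  induction η using WellFoundedLT.induction generalizing α with
  | _ η ih =>
    by_cases hη : ofColex η ∈ pommaretMult (α : Term n)
    · exact Submodule.subset_span ⟨⟨(α, ofColex η), hη⟩, rfl⟩
    · have : ∃ i ∈ (ofColex η).support, ∃ j ∈ (α : Term n).support, j < i := by
        simpa [pommaretMult] using hη
      obtain ⟨i, hi, j, hj, hji⟩ := this
      have hnot : var i ∉ pommaretMult (α : Term n) := fun h =>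
        absurd (h i (by simp) j hj) (not_le.2 hji)
      have hsub := sub_var_add hi
      have hred := hc α i hnot
      rw [← hsub, ← one_mul (1 : A), ← monomial_mul, mul_assoc]
      generalize monomial (var i) 1 * markedPoly c α = q at hred ⊢
      induction hred using Submodule.span_induction with
      | mem p hp =>
        obtain ⟨η', hη', α', rfl⟩ := hp
        rw [← mul_assoc, monomial_mul, one_mul]
        refine ih (toColex (ofColex η - var i + η')) ?_ α'
        calc toColex (ofColex η - var i + η')
            = toColex (ofColex η - var i) + toColex η' := rfl
          _ < toColex (ofColex η - var i) + toColex (var i) := add_lt_add_right hη' _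
          _ = η := congrArg toColex hsub
      | zero => simp
      | add p q _ _ hp hq => rw [mul_add]; exact add_mem hp hq
      | smul a p _ hp => rw [mul_smul_comm]; exact Submodule.smul_mem _ _ hp

theorem mem_multSpan_of_mem_markedIdeal
    (hV : ∀ (η : Term n) (α : pommaretBasis O), monomial η 1 * markedPoly c α ∈ multSpan c)
    {p : MvPolynomial (Fin n) A} (hp : p ∈ markedIdeal c) : p ∈ multSpan c := by
  induction hp using Submodule.span_induction with
  | mem p hp =>
    obtain ⟨α, rfl⟩ := hp
    have := hV 0 α
    rwa [show (monomial 0 1 : MvPolynomial (Fin n) A) = 1 from rfl, one_mul] at this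
  | zero => exact zero_mem _
  | add p q _ _ hp hq => exact add_mem hp hq
  | smul f p _ hp =>
    rw [smul_eq_mul, f.as_sum, Finset.sum_mul]
    refine sum_mem fun θ _ => ?_
    have hθ : monomial θ (coeff θ f) = coeff θ f • monomial θ (1 : A) := by
      rw [smul_monomial, smul_eq_mul, mul_one]
    rw [hθ, smul_mul_assoc]
    refine Submodule.smul_mem _ _ ?_
    refine Submodule.span_induction (p := fun q _ => monomial θ 1 * q ∈ multSpan c)
      ?_ ?_ ?_ ?_ hp
    · rintro _ ⟨x, rfl⟩
      change monomial θ 1 * (monomial x.1.2 1 * markedPoly c x.1.1) ∈ _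
      rw [← mul_assoc, monomial_mul, one_mul]
      exact hV _ _
    · simp
    · intro p q _ _ hp hq
      rw [mul_add]
      exact add_mem hp hq
    · intro a p _ hp
      rw [mul_smul_comm]
      exact Submodule.smul_mem _ _ hp

theorem monomial_mul_mem {η : Term n} {L : Set (Term n)} (hL : ∀ σ ∈ O, σ + η ∈ L)
    {p : MvPolynomial (Fin n) A} (hp : p ∈ restrictSupport A (O : Set (Term n))) :
    monomial η 1 * p ∈ restrictSupport A L := by
  rw [restrictSupport_eq_span] at hp
  induction hp using Submodule.span_induction with
  | mem p hp =>
    obtain ⟨σ, hσ, rfl⟩ := hp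
    rw [monomial_mul, monomial_mem_restrictSupport, add_comm]
    exact Or.inl (hL σ hσ)
  | zero => simp
  | add p q _ _ hp hq => rw [mul_add]; exact add_mem hp hq
  | smul a p _ hp => rw [mul_smul_comm]; exact Submodule.smul_mem _ _ hp

theorem sPoly_mem_restrictSupport {H : Finset (Term n)} (c : H × O → A) (α α' : H)
    {L : Set (Term n)} (hL : ∀ σ ∈ O, σ + ((α ⊔ α' : Term n) - α) ∈ L)
    (hL' : ∀ σ ∈ O, σ + ((α ⊔ α' : Term n) - α') ∈ L) :
    sPoly (α : Term n) α' (markedPoly c α) (markedPoly c α') ∈ restrictSupport A L := by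
  rw [sPoly_markedPoly]
  exact sub_mem (monomial_mul_mem hL' (sub_markedPoly_mem c α'))
    (monomial_mul_mem hL (sub_markedPoly_mem c α))

end Marked

/-- The ideal of the Pommaret marked scheme represents the complements of the module generated by
`O`. -/
theorem represents_pommaretIdeal (K : Type u) [Field K] (hO : IsOrderIdeal (O : Set (Term n))) :
    Represents K (pommaretIdeal K O hO) where
  exists_sub_mem := exists_sub_mem_markedIdeal_pommaret hO
  forall_aeval_iff {A} _ _ c := by
    refine ⟨fun hc h hh hI => eq_zero_of_mem_multSpan hO hh (mem_multSpan_of_mem_markedIdeal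
      (monomial_mul_markedPoly_mem_multSpan fun α i hi => ?_) hI),
      fun hc p hp => aeval_eq_zero_of_mem_coeffIdeal (J := pommaretRS O hO) c hc hp⟩
    obtain ⟨w, hw⟩ := exists_pommaretWeight O
    obtain ⟨α', hα', δ, hδ, h, hlt, hsup⟩ := exists_nonMult hO α.2 hi
    have hsub : (α : Term n) ⊔ α' - α = var i := by rw [hsup, add_tsub_cancel_right]
    have hsub' : (α : Term n) ⊔ α' - α' = δ := by rw [hsup, h, add_tsub_cancel_left]
    have hlt_of : ∀ {σ η α' η' : Term n}, σ ∈ O → α' ∈ pommaretBasis O → η' ∈ pommaretMult α' →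
        σ + η = α' + η' → toColex η' < toColex η := fun hσ hα' hη' h =>
      toColex_lt_of_add_eq h hη' fun hle => (mem_pommaretBasis.1 hα').1 (hO _ _ hσ hle)
    have hmem := sPoly_mem_span (J := pommaretRS O hO) (R := (pommaretRS O hO).IsNonMult) c hc w
      -- Both tails of the S-polynomial have multipliers at most `x_i`. Decomposing such a term
      -- outside `O` yields a multiplier strictly below `x_i`, so the reduction stays in this set
      -- and uses only these multipliers.
      {γ | ∃ σ ∈ O, ∃ η, toColex η ≤ toColex (var i) ∧ γ = σ + η}
      {η | toColex η < toColex (var i)} (by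
        rintro γ ⟨σ₀, hσ₀, η₀, hη₀, hγ₀⟩ hγO
        obtain ⟨β, hβ, η, hη, hγ, hwγ⟩ := hw γ hγO
        have hη₁ := (hlt_of hσ₀ hβ hη (hγ₀ ▸ hγ)).trans_le hη₀
        refine ⟨⟨β, hβ⟩, η, hη, hγ, hη₁, fun σ hσ =>
          ⟨⟨σ, hσ, η, hη₁.le, add_comm _ _⟩, fun hO' => ?_⟩⟩
        obtain ⟨β', hβ', η', hη', h', hw'⟩ := hw _ hO'
        rw [hwγ, hw']
        exact hlt_of hσ hβ' hη' ((add_comm _ _).trans h'))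
      (α := α) (α' := ⟨α', hα'⟩) ⟨i, hi, δ, hδ, h⟩ (sPoly_mem_restrictSupport X α ⟨α', hα'⟩
        (fun σ hσ => ⟨σ, hσ, _, hsub.symm ▸ le_rfl, rfl⟩)
        (fun σ hσ => ⟨σ, hσ, _, hsub'.symm ▸ hlt.le, rfl⟩))
    have hx : monomial (var i) 1 * markedPoly c α =
        sPoly (α : Term n) α' (markedPoly c α) (markedPoly c ⟨α', hα'⟩) +
          monomial δ 1 * markedPoly c ⟨α', hα'⟩ := by
      rw [sPoly, hsub, hsub', sub_add_cancel]
    rw [hx]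
    exact add_mem hmem (Submodule.subset_span ⟨δ, hlt, _, rfl⟩)

end Pommaret

/-! ### The empty order ideal -/

section Empty

variable {n : ℕ}

theorem coeffIdeal_empty (K : Type u) [Field K] (J : ReductionStructure n)
    (R : Term n → Term n → Prop) : coeffIdeal K ∅ J R = ⊥ := by
  refine Ideal.span_eq_bot.2 ?_
  rintro _ ⟨α, α', -, h, -, hh, γ, rfl⟩
  exact notMem_support_iff.1 fun hγ => by simpa using hh hγ

/-- For empty `O` there are no parameters. -/
def quotientCoeffIdealEmptyEquiv (K : Type u) [Field K] (J : ReductionStructure n)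
    (R : Term n → Term n → Prop) :
    (ParamRing K J.head (∅ : Finset (Term n)) ⧸ coeffIdeal K ∅ J R) ≃ₐ[K] K :=
  (Ideal.quotientEquivAlgOfEq K (coeffIdeal_empty K J R)).trans
    ((AlgEquiv.quotientBot K _).trans (isEmptyAlgEquiv K _))

end Empty

end MarkedBases

end

open MarkedBases in
theorem corollary3p5 (K : Type u) [Field K] {n : ℕ} (O : Finset (MarkedBases.Term n))
    (hO : MarkedBases.IsOrderIdeal (O : Set (MarkedBases.Term n)))
    (β : Fin (MarkedBases.border O).card ≃ MarkedBases.border O)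
    (hβ : Monotone fun i => (β i : MarkedBases.Term n).degree) :
    Nonempty (MarkedBases.borderMarkedScheme K O hO β ≅
      MarkedBases.pommaretMarkedScheme K O hO) := by
  have h : Nonempty ((ParamRing K (border O) O ⧸ borderIdeal K O hO β) ≃ₐ[K]
      (ParamRing K (pommaretBasis O) O ⧸ pommaretIdeal K O hO)) := by
    -- For empty `O` the border is empty and its marked ideal is zero, so normal forms modulo it do
    -- not exist; but there are no parameters and both quotients are `K`.
    rcases O.eq_empty_or_nonempty with rfl | ⟨τ, hτ⟩
    · exact ⟨(quotientCoeffIdealEmptyEquiv K (borderRS ∅ hO β) _).trans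
        (quotientCoeffIdealEmptyEquiv K (pommaretRS ∅ hO) _).symm⟩
    · exact (represents_borderIdeal K (hO 0 τ hτ zero_le) hO β hβ).nonempty_algEquiv
        (represents_pommaretIdeal K hO)
  obtain ⟨e⟩ := h
  exact nonempty_specOver_iso e
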